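/- \textbf{Setting (the original camel--banana problem of Klarner).} A camel moves along a straight line, with the border of the desert at position $0$ and the desert in the positive direction. The camel uses the fuel of one banana per mile walked, in either direction, and cannot walk with an empty stomach. Its stomach has room for one banana, and bananas are eaten whole, so the camel can eat a banana only when its stomach is empty; after that its stomach contains one unit of fuel. The camel can carry at most one banana at a time. At its current position it may pick up a banana, lay down the carried banana, or eat a banana that lies there or that it carries. To start with $N$ bananas, for a real number $N \ge 0$, means that the camel is at position $0$ with $\lfloor N\rfloor$ bananas lying at position $0$, no banana on its back, and $N-\lfloor N\rfloor$ units of banana fuel in its stomach. The camel does not need to return. \textbf{Theorem.} Let $k \ge 1$ be an integer and let $f$ be a real number with $0\le f\le 2$. If the camel starts with $2^k+f$ bananas, then the largest position that it can reach by finitely many such actions exists and equals $$\frac{k}{2} + \frac{11}{6} + \frac{f-1}{3\cdot 2^{k-1}} .$$ -/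

import Mathlib

/-- A situation in Klarner's camel-banana problem, on a straight line on which the border of the
desert is position `0` and the desert extends in the positive direction (unit: one mile). -/
structure CamelState where
  /-- the position of the camel -/
  pos : ℝ
  /-- the amount of banana fuel in the camel's stomach -/
  stomach : ℝ
  /-- whether the camel carries a banana (it carries at most one) -/
  carrying : Bool
  /-- the positions, with multiplicity, of the bananas lying on the ground -/
  stock : Multiset ℝ

/-- The elementary actions of the camel. -/
inductive CamelStep : CamelState → CamelState → Prop
  /-- Walk straight from `x` to `y`, using one banana of fuel per mile; the stomach must contain
  enough fuel. A carried banana comes along. -/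
  | walk (x y s : ℝ) (c : Bool) (G : Multiset ℝ) (h : |y - x| ≤ s) :
      CamelStep ⟨x, s, c, G⟩ ⟨y, s - |y - x|, c, G⟩
  /-- Pick up a banana lying at the position of the camel, which carries none. -/
  | pickUp (x s : ℝ) (G : Multiset ℝ) :
      CamelStep ⟨x, s, false, x ::ₘ G⟩ ⟨x, s, true, G⟩
  /-- Lay down the carried banana. -/
  | layDown (x s : ℝ) (G : Multiset ℝ) :
      CamelStep ⟨x, s, true, G⟩ ⟨x, s, false, x ::ₘ G⟩
  /-- Eat a whole banana lying at the position of the camel. The stomach has room for one banana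
  only, so it must be empty before and is full afterwards. -/
  | eatStock (x : ℝ) (c : Bool) (G : Multiset ℝ) :
      CamelStep ⟨x, 0, c, x ::ₘ G⟩ ⟨x, 1, c, G⟩
  /-- Eat the carried banana, under the same condition. -/
  | eatCarried (x : ℝ) (G : Multiset ℝ) :
      CamelStep ⟨x, 0, true, G⟩ ⟨x, 1, false, G⟩

/-- The initial situation with `N ≥ 0` bananas, `N` real: the camel is at the border, with `⌊N⌋`
bananas next to it and `N - ⌊N⌋` banana units in its stomach. -/
noncomputable def camelStart (N : ℝ) : CamelState where
  pos := 0
  stomach := N - ⌊N⌋₊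
  carrying := false
  stock := Multiset.replicate ⌊N⌋₊ 0

/-- With `N` bananas the camel can get to position `d` (one way) by finitely many actions. -/
def CamelCanReach (N d : ℝ) : Prop :=
  ∃ S : CamelState, Relation.ReflTransGen CamelStep (camelStart N) S ∧ S.pos = d

/-! ### The potential -/

/-! Half a mile of transport doubles the price of a banana: one of two is eaten while the other is
carried half a mile and the camel returns. Far from the goal a banana at `-m/2` is thus worth `2⁻ᵐ`,
and `camelProfile` interpolates such prices. The upper bound rests on a potential,
`CamelState.value`, which no action increases (`CamelStep.value_le`). With origin `c = m/2` and goal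
`2 + e`, it is at most `1 + (N - 1)/2ᵐ` at the start and at least `2 + 3e` at the goal; `N = 2 ^ (m
+ 1) + f` gives the claim. Beyond `e` the banana price is constant and fuel counts mainly by the
range it gives.

The matching strategy moves the stock by half-mile round trips, keeping two bananas `q` ahead, with
`q = f/4` at first. Each stage turns `q` into `q/2 + 1/8`, so `q - 1/4` is halved, whence the term
in `f - 1`. The last stage puts two bananas and the camel `(2 + 2q)/3` ahead, and these give two
more miles. For `k = 1`, two bananas are gathered at `f/3` directly. -/

/-- The piecewise linear convex function with value `2⁻ᵐ` at `-m/2` for every natural number `m`,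
and equal to `1 + x` for `x ≥ -1/2`. -/
noncomputable def camelProfile (x : ℝ) : ℝ := ⨆ j : ℕ, (2 + j + 2 * x) / 2 ^ (j + 1)

theorem one_add_le_two_pow (n : ℕ) : (1 : ℝ) + n ≤ 2 ^ n := by
  have h : n + 1 ≤ 2 ^ n := Nat.lt_two_pow_self
  have h' : ((n + 1 : ℕ) : ℝ) ≤ ((2 ^ n : ℕ) : ℝ) := by exact_mod_cast h
  push_cast at h'
  linarith

theorem camelProfile_line_le (x : ℝ) (j : ℕ) :
    (2 + j + 2 * x) / 2 ^ (j + 1) ≤ camelProfile x := by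
  refine le_ciSup (f := fun j : ℕ => (2 + (j : ℝ) + 2 * x) / 2 ^ (j + 1)) ⟨1 + |x|, ?_⟩ j
  rintro _ ⟨i, rfl⟩
  have h1 := one_add_le_two_pow i
  have h2 : (1 : ℝ) ≤ 2 ^ i := one_le_pow₀ (by norm_num)
  have h3 := le_abs_self x
  have h4 := abs_nonneg x
  simp only
  rw [div_le_iff₀ (by positivity), pow_succ]
  nlinarith

theorem camelProfile_nonneg (x : ℝ) : 0 ≤ camelProfile x := by
  refine le_trans ?_ (camelProfile_line_le x ⌈-2 * x⌉₊)
  have := Nat.le_ceil (-2 * x)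
  exact div_nonneg (by linarith) (by positivity)

theorem camelProfile_mono : Monotone camelProfile := fun x y h => by
  refine ciSup_le fun j => le_trans ?_ (camelProfile_line_le y j)
  gcongr

theorem camelProfile_of_ge {x : ℝ} (hx : -1 / 2 ≤ x) : camelProfile x = 1 + x := by
  apply le_antisymm
  · refine ciSup_le fun j => ?_
    have h1 := one_add_le_two_pow j
    have h2 : (1 : ℝ) ≤ 2 ^ j := one_le_pow₀ (by norm_num)
    rw [div_le_iff₀ (by positivity), pow_succ]
    nlinarith
  · have := camelProfile_line_le x 0
    norm_num at this
    linarith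

theorem camelProfile_neg_half (m : ℕ) : camelProfile (-(m : ℝ) / 2) = 1 / 2 ^ m := by
  apply le_antisymm
  · refine ciSup_le fun j => ?_
    rw [div_le_div_iff₀ (by positivity) (by positivity), one_mul]
    rcases le_total m (j + 1) with h | h
    · obtain ⟨n, hn⟩ := Nat.exists_eq_add_of_le h
      have hj : (j : ℝ) + 1 = m + n := by exact_mod_cast hn
      rw [hn, pow_add, mul_comm]
      have := one_add_le_two_pow n
      gcongr
      linarith
    · rcases h.eq_or_lt with h | h
      · have hj : (j : ℝ) + 1 = m := by exact_mod_cast h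
        rw [h, ← hj]
        have : (0 : ℝ) < 2 ^ m := by positivity
        nlinarith
      · have hj : (j : ℝ) + 1 + 1 ≤ m := by exact_mod_cast h
        have h1 : (0 : ℝ) < 2 ^ m := by positivity
        have h2 : (0 : ℝ) < 2 ^ (j + 1) := by positivity
        nlinarith
  · rcases m with _ | m
    · rw [camelProfile_of_ge (by norm_num)]; norm_num
    · refine le_trans (le_of_eq ?_) (camelProfile_line_le _ m)
      push_cast
      ring

theorem camelProfile_le_two_mul (x : ℝ) : camelProfile x ≤ 2 * camelProfile (x - 1 / 2) := by
  refine ciSup_le fun j => ?_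
  have := camelProfile_line_le (x - 1 / 2) (j + 1)
  refine le_trans (le_of_eq ?_) (mul_le_mul_of_nonneg_left this zero_le_two)
  push_cast
  rw [pow_succ _ (j + 1)]
  field_simp
  ring

theorem camelProfile_convex : ConvexOn ℝ Set.univ camelProfile := by
  refine ⟨convex_univ, fun x _ y _ a b ha hb hab => ciSup_le fun j => ?_⟩
  have hx := mul_le_mul_of_nonneg_left (camelProfile_line_le x j) ha
  have hy := mul_le_mul_of_nonneg_left (camelProfile_line_le y j) hb
  refine le_trans (le_of_eq ?_) (add_le_add hx hy)
  obtain rfl : b = 1 - a := by linarith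
  simp only [smul_eq_mul]
  ring

theorem ConvexOn.add_le_add_of_mem_Icc {h : ℝ → ℝ} (hh : ConvexOn ℝ Set.univ h) {a d w z : ℝ}
    (hw : a ≤ w) (hw' : w ≤ d) (hs : w + z = a + d) : h w + h z ≤ h a + h d := by
  rcases (hw.trans hw').eq_or_lt with rfl | had
  · obtain rfl : w = a := le_antisymm hw' hw
    obtain rfl : z = w := by linarith
    rfl
  have hd : 0 < d - a := by linarith
  have h1 : 0 ≤ (d - w) / (d - a) := div_nonneg (by linarith) hd.le
  have h2 : 0 ≤ (w - a) / (d - a) := div_nonneg (by linarith) hd.le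
  have h12 : (d - w) / (d - a) + (w - a) / (d - a) = 1 := by field_simp; ring
  have e1 := hh.2 (Set.mem_univ a) (Set.mem_univ d) h1 h2 h12
  have e2 := hh.2 (Set.mem_univ d) (Set.mem_univ a) h1 h2 h12
  have p1 : (d - w) / (d - a) * a + (w - a) / (d - a) * d = w := by field_simp; ring
  have p2 : (d - w) / (d - a) * d + (w - a) / (d - a) * a = z := by
    obtain rfl : z = a + d - w := by linarith
    field_simp; ring
  simp only [smul_eq_mul, p1, p2] at e1 e2
  calc h w + h z ≤ _ := add_le_add e1 e2
    _ = ((d - w) / (d - a) + (w - a) / (d - a)) * (h a + h d) := by ring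
    _ = h a + h d := by rw [h12, one_mul]

/-- By convexity the second half of `[a, a + 2t]` gains at least as much as the first, and shifting
the interval to the right does not lower its gain. -/
theorem camelProfile_increment {a b t : ℝ} (hab : a ≤ b) (ht : 0 ≤ t) :
    2 * (camelProfile (a + t) - camelProfile a) ≤
      camelProfile (b + 2 * t) - camelProfile b := by
  have h1 := camelProfile_convex.add_le_add_of_mem_Icc (a := a) (d := a + 2 * t) (w := a + t)
    (z := a + t) (by linarith) (by linarith) (by ring)
  have h2 := camelProfile_convex.add_le_add_of_mem_Icc (a := a) (d := b + 2 * t) (w := b)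
    (z := a + 2 * t) hab (by linarith) (by ring)
  linarith

/-! ### Prices of bananas and fuel before `e` -/

/-- The value of a banana at position `x`, as long as the position matters. -/
noncomputable def bananaValue (x : ℝ) : ℝ := 2 * camelProfile (x - 1 / 2)

theorem bananaValue_nonneg (x : ℝ) : 0 ≤ bananaValue x :=
  mul_nonneg zero_le_two (camelProfile_nonneg _)

theorem bananaValue_mono : Monotone bananaValue := fun x y h =>
  mul_le_mul_of_nonneg_left (camelProfile_mono (by linarith)) zero_le_two

theorem bananaValue_of_nonneg {x : ℝ} (hx : 0 ≤ x) : bananaValue x = 1 + 2 * x := by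
  rw [bananaValue, camelProfile_of_ge (by linarith)]; ring

theorem bananaValue_neg_half (m : ℕ) : bananaValue (-(m : ℝ) / 2) = 1 / 2 ^ m := by
  have := camelProfile_neg_half (m + 1)
  push_cast at this
  rw [bananaValue, show -(m : ℝ) / 2 - 1 / 2 = -((m : ℝ) + 1) / 2 by ring, this, pow_succ]
  field_simp

/-- The value of the camel at position `x` with `s` units of fuel, far from the goal. -/
noncomputable def nearValue (x s : ℝ) : ℝ :=
  if s ≤ 1 / 2 then 1 - camelProfile (x - s) else 1 + camelProfile (x + s - 1) - bananaValue x

theorem nearValue_of_le {x s : ℝ} (hs : s ≤ 1 / 2) : nearValue x s = 1 - camelProfile (x - s) :=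
  if_pos hs

theorem nearValue_of_ge {x s : ℝ} (hs : 1 / 2 ≤ s) :
    nearValue x s = 1 + camelProfile (x + s - 1) - bananaValue x := by
  rcases hs.eq_or_lt with rfl | hs
  · rw [nearValue_of_le le_rfl, bananaValue, show x + 1 / 2 - 1 = x - 1 / 2 by ring]
    ring
  · exact if_neg hs.not_ge

theorem nearValue_of_nonneg {x s : ℝ} (hx : 0 ≤ x) : nearValue x s = s - x := by
  rcases le_total s (1 / 2) with h | h
  · rw [nearValue_of_le h, camelProfile_of_ge (by linarith)]; ring
  · rw [nearValue_of_ge h, camelProfile_of_ge (by linarith), bananaValue_of_nonneg hx]; ring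

/-- While half a unit of fuel remains, `x + s` is constant and the sum is preserved. Below that, the
loss in fuel value outweighs the gain of the carried banana by `camelProfile_increment`. -/
theorem nearValue_forward {x s t : ℝ} (ht : 0 ≤ t) :
    nearValue (x + t) (s - t) + bananaValue (x + t) ≤ nearValue x s + bananaValue x := by
  have low : ∀ {y r u : ℝ}, r ≤ 1 / 2 → 0 ≤ u →
      nearValue (y + u) (r - u) + bananaValue (y + u) ≤ nearValue y r + bananaValue y := by
    intro y r u hr hu
    rw [nearValue_of_le hr, nearValue_of_le (by linarith), bananaValue, bananaValue]
    have := camelProfile_increment (a := y - 1 / 2) (b := y - r) (by linarith) hu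
    rw [show y + u - (r - u) = y - r + 2 * u by ring,
      show y + u - 1 / 2 = y - 1 / 2 + u by ring]
    linarith
  have high : ∀ {y r u : ℝ}, 1 / 2 ≤ r - u → 0 ≤ u →
      nearValue (y + u) (r - u) + bananaValue (y + u) ≤ nearValue y r + bananaValue y := by
    intro y r u hr hu
    rw [nearValue_of_ge hr, nearValue_of_ge (by linarith),
      show y + u + (r - u) - 1 = y + r - 1 by ring]
    linarith
  rcases le_total s (1 / 2) with h | h
  · exact low h ht
  rcases le_total (1 / 2) (s - t) with h' | h'
  · exact high h' ht
  -- The walk is cut where the fuel level is `1/2`.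
  have h1 := high (y := x) (r := s) (u := s - 1 / 2) (by linarith) (by linarith)
  have h2 := low (y := x + (s - 1 / 2)) (r := s - (s - 1 / 2)) (u := t - (s - 1 / 2))
    (by linarith) (by linarith)
  rw [show x + (s - 1 / 2) + (t - (s - 1 / 2)) = x + t by ring,
    show s - (s - 1 / 2) - (t - (s - 1 / 2)) = s - t by ring] at h2
  exact h2.trans h1

/-- The roles are exchanged: with little fuel, `x - s` and hence the value is constant, so a round
trip that turns back at fuel `1/2` loses nothing. -/
theorem nearValue_backward {x s t : ℝ} (ht : 0 ≤ t) :
    nearValue (x - t) (s - t) ≤ nearValue x s := by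
  have low : ∀ {y r u : ℝ}, r ≤ 1 / 2 → 0 ≤ u → nearValue (y - u) (r - u) ≤ nearValue y r := by
    intro y r u hr hu
    rw [nearValue_of_le hr, nearValue_of_le (by linarith), show y - u - (r - u) = y - r by ring]
  have high : ∀ {y r u : ℝ}, 1 / 2 ≤ r - u → 0 ≤ u →
      nearValue (y - u) (r - u) ≤ nearValue y r := by
    intro y r u hr hu
    rw [nearValue_of_ge hr, nearValue_of_ge (by linarith), bananaValue, bananaValue]
    have := camelProfile_increment (a := y - 1 / 2 - u) (b := y + r - 1 - 2 * u)
      (by linarith) hu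
    rw [show y - 1 / 2 - u + u = y - 1 / 2 by ring,
      show y + r - 1 - 2 * u + 2 * u = y + r - 1 by ring] at this
    rw [show y - u + (r - u) - 1 = y + r - 1 - 2 * u by ring,
      show y - u - 1 / 2 = y - 1 / 2 - u by ring]
    linarith
  rcases le_total s (1 / 2) with h | h
  · exact low h ht
  rcases le_total (1 / 2) (s - t) with h' | h'
  · exact high h' ht
  have h1 := high (y := x) (r := s) (u := s - 1 / 2) (by linarith) (by linarith)
  have h2 := low (y := x - (s - 1 / 2)) (r := s - (s - 1 / 2)) (u := t - (s - 1 / 2))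
    (by linarith) (by linarith)
  rw [show x - (s - 1 / 2) - (t - (s - 1 / 2)) = x - t by ring,
    show s - (s - 1 / 2) - (t - (s - 1 / 2)) = s - t by ring] at h2
  exact h2.trans h1

theorem nearValue_eat (x : ℝ) : nearValue x 1 ≤ nearValue x 0 + bananaValue x := by
  rw [nearValue_of_ge (by norm_num), nearValue_of_le (by norm_num)]
  have := camelProfile_le_two_mul x
  rw [bananaValue, show x + 1 - 1 = x by ring, show x - 0 = x by ring]
  linarith

/-! ### Fuel beyond `e` -/

/-- The value of being able to get to position `y` on the last two bananas, when two bananas are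
needed at position `e` to get to the goal `2 + e`. -/
noncomputable def farValue (e y : ℝ) : ℝ :=
  if y < 1 + e then -e else if y < 2 + e then 1 + e else 2 + 3 * e

theorem farValue_mono {e : ℝ} (he : 0 ≤ e) : Monotone (farValue e) := by
  intro x y h
  unfold farValue
  split_ifs <;> linarith

/-- The value of the camel at position `x` with `s` units of fuel. -/
noncomputable def fuelValue (e x s : ℝ) : ℝ :=
  if x < e then nearValue x s else max (s - x) (farValue e (x + s))

theorem fuelValue_forward {e x y s : ℝ} (he : 0 ≤ e) (hxy : x ≤ y) (hs : y - x ≤ s)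
    (hs1 : s ≤ 1) :
    fuelValue e y (s - (y - x)) + bananaValue (min y e) ≤
      fuelValue e x s + bananaValue (min x e) := by
  unfold fuelValue
  split_ifs with hy hx hx
  · rw [min_eq_left hy.le, min_eq_left hx.le]
    have := nearValue_forward (x := x) (s := s) (t := y - x) (by linarith)
    rwa [show x + (y - x) = y by ring] at this
  · linarith
  · rw [min_eq_right (not_lt.1 hy), min_eq_left hx.le]
    have := nearValue_forward (x := x) (s := s) (t := e - x) (by linarith)
    rw [show x + (e - x) = e by ring, nearValue_of_nonneg he] at this
    -- Since `x < e` and `s ≤ 1`, the range is below the first threshold.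
    have hf : farValue e (y + (s - (y - x))) = -e := if_pos (by linarith)
    rw [hf]
    have : max (s - (y - x) - y) (-e) ≤ s - (e - x) - e := max_le (by linarith) (by linarith)
    linarith
  · rw [min_eq_right (not_lt.1 hy), min_eq_right (not_lt.1 hx),
      show y + (s - (y - x)) = x + s by ring]
    gcongr
    linarith

theorem fuelValue_backward {e x y s : ℝ} (he : 0 ≤ e) (hxy : y ≤ x) :
    fuelValue e y (s - (x - y)) ≤ fuelValue e x s := by
  unfold fuelValue
  split_ifs with hy hx hx
  · have := nearValue_backward (x := x) (s := s) (t := x - y) (by linarith)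
    rwa [show x - (x - y) = y by ring] at this
  · refine le_trans ?_ (le_max_left _ _)
    have := nearValue_backward (x := e) (s := s - (x - e)) (t := e - y) (by linarith)
    rw [nearValue_of_nonneg he, show e - (e - y) = y by ring,
      show s - (x - e) - (e - y) = s - (x - y) by ring] at this
    linarith
  · linarith
  · exact max_le_max (by linarith) (farValue_mono he (by linarith))

/-- The thresholds of `farValue` are a mile apart and each jump is `1 + 2e`, the banana price from
`e` on; one meal crosses at most one of them. -/
theorem fuelValue_eat {e : ℝ} (he : 0 ≤ e) (x : ℝ) :
    fuelValue e x 1 ≤ fuelValue e x 0 + bananaValue (min x e) := by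
  unfold fuelValue
  split_ifs with hx
  · rw [min_eq_left hx.le]
    exact nearValue_eat x
  · rw [min_eq_right (not_lt.1 hx), bananaValue_of_nonneg he]
    have h : max (1 - x) (farValue e (x + 1)) ≤ farValue e (x + 0) + (1 + 2 * e) := by
      unfold farValue
      apply max_le <;> split_ifs <;> linarith
    exact h.trans (by gcongr; exact le_max_right _ _)

/-! ### The potential never increases -/

/-- The total value of a situation, when positions are measured from `c`. -/
noncomputable def CamelState.value (e c : ℝ) (S : CamelState) : ℝ :=
  (S.stock.map fun y => bananaValue (min (y - c) e)).sum +
    (if S.carrying then bananaValue (min (S.pos - c) e) else 0) +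
    fuelValue e (S.pos - c) S.stomach

theorem CamelStep.value_le {e c : ℝ} (he : 0 ≤ e) {S T : CamelState} (h : CamelStep S T)
    (hS : S.stomach ≤ 1) : T.stomach ≤ 1 ∧ T.value e c ≤ S.value e c := by
  cases h with
  | walk x y s b G h =>
    simp only at hS
    refine ⟨by simp only; linarith [abs_nonneg (y - x)], ?_⟩
    simp only [CamelState.value]
    rcases le_total x y with hxy | hxy
    · rw [abs_of_nonneg (by linarith)] at h ⊢
      have h1 := fuelValue_forward (x := x - c) (y := y - c) (s := s) he (by linarith)
        (by linarith) hS
      rw [show y - c - (x - c) = y - x by ring] at h1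
      have h2 : bananaValue (min (x - c) e) ≤ bananaValue (min (y - c) e) :=
        bananaValue_mono (min_le_min_right _ (by linarith))
      split_ifs <;> linarith
    · rw [abs_of_nonpos (by linarith)]
      have h1 := fuelValue_backward (x := x - c) (y := y - c) (s := s) he (by linarith)
      rw [show x - c - (y - c) = -(y - x) by ring] at h1
      have h2 : bananaValue (min (y - c) e) ≤ bananaValue (min (x - c) e) :=
        bananaValue_mono (min_le_min_right _ (by linarith))
      split_ifs <;> linarith
  | pickUp x s G =>
    refine ⟨hS, ?_⟩
    simp [CamelState.value]
    linarith
  | layDown x s G =>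
    refine ⟨hS, ?_⟩
    simp [CamelState.value]
    linarith
  | eatStock x b G =>
    refine ⟨le_rfl, ?_⟩
    have := fuelValue_eat he (x - c)
    simp only [CamelState.value, Multiset.map_cons, Multiset.sum_cons]
    linarith
  | eatCarried x G =>
    refine ⟨le_rfl, ?_⟩
    have := fuelValue_eat he (x - c)
    simp [CamelState.value]
    linarith

theorem camel_value_le {e c : ℝ} (he : 0 ≤ e) {S T : CamelState}
    (h : Relation.ReflTransGen CamelStep S T) (hS : S.stomach ≤ 1) :
    T.stomach ≤ 1 ∧ T.value e c ≤ S.value e c := by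
  induction h with
  | refl => exact ⟨hS, le_rfl⟩
  | tail _ h ih =>
    have := h.value_le (c := c) he ih.1
    exact ⟨this.1, this.2.trans ih.2⟩

theorem CamelStep.stomach_nonneg {S T : CamelState} (h : CamelStep S T) (hS : 0 ≤ S.stomach) :
    0 ≤ T.stomach := by
  cases h with
  | walk x y s b G h => simp only; linarith
  | pickUp | layDown => exact hS
  | eatStock | eatCarried => exact zero_le_one

theorem CamelState.le_value {e c : ℝ} {S : CamelState} (hs : 0 ≤ S.stomach)
    (hpos : 2 + e ≤ S.pos - c) : 2 + 3 * e ≤ S.value e c := by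
  have h1 : 0 ≤ (S.stock.map fun y => bananaValue (min (y - c) e)).sum := by
    apply Multiset.sum_nonneg
    simp only [Multiset.mem_map]
    rintro _ ⟨y, -, rfl⟩
    exact bananaValue_nonneg _
  have h2 : 0 ≤ if S.carrying then bananaValue (min (S.pos - c) e) else 0 := by
    split_ifs
    exacts [bananaValue_nonneg _, le_rfl]
  have h3 : 2 + 3 * e ≤ fuelValue e (S.pos - c) S.stomach := by
    rw [fuelValue, if_neg (by linarith)]
    refine le_trans (le_of_eq ?_) (le_max_right _ _)
    rw [farValue, if_neg (by linarith), if_neg (by linarith)]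
  unfold CamelState.value
  linarith

/-- The bound is affine in `s` with slope `2⁻ᵐ`, the banana price there, so stomach fuel and whole
bananas together give a bound affine in `N`. -/
theorem nearValue_neg_half_le (m : ℕ) {s : ℝ} (hs1 : s ≤ 1) :
    nearValue (-(m : ℝ) / 2) s ≤ 1 - (1 - s) / 2 ^ m := by
  rcases le_total s (1 / 2) with h | h
  · rw [nearValue_of_le h]
    have := camelProfile_line_le (-(m : ℝ) / 2 - s) m
    rw [show (2 + (m : ℝ) + 2 * (-(m : ℝ) / 2 - s)) / 2 ^ (m + 1) = (1 - s) / 2 ^ m by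
      rw [pow_succ]; field_simp; ring] at this
    linarith
  · rw [nearValue_of_ge h, bananaValue_neg_half]
    have h1 := camelProfile_convex.2 (Set.mem_univ (-((m + 1 : ℕ) : ℝ) / 2))
      (Set.mem_univ (-(m : ℝ) / 2))
      (show 0 ≤ 2 - 2 * s by linarith) (show 0 ≤ 2 * s - 1 by linarith) (by ring)
    rw [camelProfile_neg_half, camelProfile_neg_half] at h1
    simp only [smul_eq_mul] at h1
    rw [show (2 - 2 * s) * (-((m + 1 : ℕ) : ℝ) / 2) + (2 * s - 1) * (-(m : ℝ) / 2) =
      -(m : ℝ) / 2 + s - 1 by push_cast; ring] at h1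
    have h2 : (2 - 2 * s) * (1 / 2 ^ (m + 1)) + (2 * s - 1) * (1 / 2 ^ m) = s / 2 ^ m := by
      rw [pow_succ]; field_simp; ring
    rw [h2] at h1
    have h3 : (1 - s) / 2 ^ m = 1 / 2 ^ m - s / 2 ^ m := by ring
    linarith

theorem camelStart_value_le {e N : ℝ} (he : 0 < e) (m : ℕ) :
    (camelStart N).value e (m / 2) ≤ 1 + (N - 1) / 2 ^ m := by
  have hx : -((m : ℝ)) / 2 < e := lt_of_le_of_lt (by
    have : (0 : ℝ) ≤ m := Nat.cast_nonneg m
    linarith) he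
  have h := nearValue_neg_half_le m (s := N - ⌊N⌋₊)
    (by linarith [Nat.lt_floor_add_one N])
  simp only [CamelState.value, camelStart, Multiset.map_replicate, Multiset.sum_replicate,
    Bool.false_eq_true, if_false, zero_sub, ← neg_div]
  rw [min_eq_left hx.le, bananaValue_neg_half, fuelValue, if_pos hx, nsmul_eq_mul]
  have h2 : 1 + (N - 1) / 2 ^ m =
      ⌊N⌋₊ * (1 / 2 ^ m) + (1 - (1 - (N - ⌊N⌋₊)) / 2 ^ m) := by ring
  linarith

theorem CamelCanReach.le {N d : ℝ} (hN : 0 ≤ N) (m : ℕ) (h : CamelCanReach N d)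
    (hd : (m : ℝ) / 2 + 2 < d) :
    3 * (d - m / 2) - 4 ≤ 1 + (N - 1) / 2 ^ m := by
  obtain ⟨S, hS, rfl⟩ := h
  -- This `e` makes the position reached exactly the goal `2 + e`.
  have he : 0 < S.pos - m / 2 - 2 := by linarith
  have h0 : 0 ≤ S.stomach := by
    have : 0 ≤ (camelStart N).stomach := by
      simp only [camelStart]; linarith [Nat.floor_le hN]
    clear he hd
    induction hS with
    | refl => exact this
    | tail _ h ih => exact h.stomach_nonneg ih
  have h1 := (camel_value_le (c := m / 2) he.le hS
    (by simp only [camelStart]; linarith [Nat.lt_floor_add_one N])).2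
  have h2 := CamelState.le_value (e := S.pos - m / 2 - 2) (c := m / 2) h0 (by linarith)
  have h3 := camelStart_value_le (N := N) he m
  linarith

/-! ### The strategy -/

/-- Reachability by finitely many actions. -/
local infix:50 " ⟶* " => Relation.ReflTransGen CamelStep

theorem camel_walk {x y s t : ℝ} {G : Multiset ℝ} (h : |y - x| ≤ s) (ht : t = s - |y - x|) :
    (⟨x, s, false, G⟩ : CamelState) ⟶* ⟨y, t, false, G⟩ := by
  subst ht
  exact .single (.walk x y s false G h)

theorem camel_carry {x y s t : ℝ} {G : Multiset ℝ} (h : |y - x| ≤ s) (ht : t = s - |y - x|) :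
    (⟨x, s, false, x ::ₘ G⟩ : CamelState) ⟶* ⟨y, t, false, y ::ₘ G⟩ := by
  subst ht
  exact ((Relation.ReflTransGen.single (.pickUp x s G)).tail (.walk x y s true G h)).tail
    (.layDown y _ G)

theorem camel_eat (x : ℝ) (G : Multiset ℝ) :
    (⟨x, 0, false, x ::ₘ G⟩ : CamelState) ⟶* ⟨x, 1, false, G⟩ :=
  .single (.eatStock x false G)

/-- Bring a banana from the present position `a` and another one from `b` to `p`. -/
theorem camel_gather {a b p s t : ℝ} {G : Multiset ℝ} (ha : a ≤ p) (hb : b ≤ p) (ht : 0 ≤ t)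
    (hs : s = t + (p - a) + 2 * (p - b)) :
    (⟨a, s, false, a ::ₘ b ::ₘ G⟩ : CamelState) ⟶* ⟨p, t, false, p ::ₘ p ::ₘ G⟩ := by
  have e1 : |p - a| = p - a := abs_of_nonneg (by linarith)
  have e2 : |b - p| = p - b := by rw [abs_sub_comm]; exact abs_of_nonneg (by linarith)
  have e3 : |p - b| = p - b := abs_of_nonneg (by linarith)
  refine (camel_carry (y := p) (t := t + 2 * (p - b)) (by linarith) (by linarith)).trans ?_
  rw [Multiset.cons_swap]
  refine (camel_walk (y := b) (t := t + (p - b)) (by linarith) (by linarith)).trans ?_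
  exact camel_carry (by linarith) (by linarith)

/-- As `camel_gather`, but the camel returns. -/
theorem camel_gather_return {a b p s t : ℝ} {G : Multiset ℝ} (ha : a ≤ p) (hb : b ≤ p)
    (ht : 0 ≤ t) (hs : s = t + 2 * (p - a) + 2 * (p - b)) :
    (⟨a, s, false, a ::ₘ b ::ₘ G⟩ : CamelState) ⟶* ⟨a, t, false, p ::ₘ p ::ₘ G⟩ := by
  refine (camel_gather (t := t + (p - a)) ha hb (by linarith) (by linarith)).trans ?_
  have : |a - p| = p - a := by rw [abs_sub_comm]; exact abs_of_nonneg (by linarith)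
  exact camel_walk (by linarith) (by linarith)

/-! ### Half-mile stages -/

theorem camel_round_trips (x : ℝ) (n : ℕ) (G : Multiset ℝ) :
    (⟨x, 0, false, Multiset.replicate (2 * n) x + G⟩ : CamelState) ⟶*
      ⟨x, 0, false, Multiset.replicate n (x + 1 / 2) + G⟩ := by
  induction n generalizing G with
  | zero => simpa using Relation.ReflTransGen.refl
  | succ n ih =>
    rw [show 2 * (n + 1) = 2 * n + 1 + 1 by ring]
    simp only [Multiset.replicate_succ, Multiset.cons_add]
    refine (camel_eat _ _).trans ?_
    have e1 : |x + 1 / 2 - x| = 1 / 2 := by rw [add_sub_cancel_left]; norm_num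
    have e2 : |x - (x + 1 / 2)| = 1 / 2 := by rw [abs_sub_comm, e1]
    refine (camel_carry (y := x + 1 / 2) (t := 1 / 2) (by rw [e1]; norm_num)
      (by rw [e1]; norm_num)).trans ?_
    refine (camel_walk (y := x) (t := 0) e2.le (by rw [e2]; norm_num)).trans ?_
    simp only [← Multiset.add_cons]
    exact ih _

theorem camel_two_bananas (p : ℝ) (G : Multiset ℝ) :
    ∃ S, (⟨p, 0, false, p ::ₘ p ::ₘ G⟩ : CamelState) ⟶* S ∧ S.pos = p + 2 := by
  refine ⟨⟨p + 1 + 1, 0, false, G⟩, ?_, by norm_num [add_assoc]⟩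
  refine (camel_eat _ _).trans ?_
  refine (camel_carry (y := p + 1) (t := 0) (by simp) (by simp)).trans ?_
  refine (camel_eat _ _).trans ?_
  exact camel_walk (by simp) (by simp)

/-- The fuel `1 - q` left on arrival at `x + q` pays for a round trip that takes one banana further
ahead. -/
theorem camel_advance {x q : ℝ} (hq : 0 ≤ q) (hq' : q ≤ 1) (G : Multiset ℝ) :
    (⟨x, 0, false, x ::ₘ x ::ₘ (x + q) ::ₘ (x + q) ::ₘ G⟩ : CamelState) ⟶*
      ⟨x + q, 1, false, (x + q) ::ₘ (x + (1 + q) / 2) ::ₘ G⟩ := by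
  have e1 : |x + q - x| = q := by rw [add_sub_cancel_left]; exact abs_of_nonneg hq
  have e2 : |x + (1 + q) / 2 - (x + q)| = (1 - q) / 2 := by
    rw [abs_of_nonneg (by linarith)]; ring
  refine (camel_eat _ _).trans ?_
  refine (camel_carry (y := x + q) (t := 1 - q) (by linarith) (by linarith)).trans ?_
  refine (camel_carry (y := x + (1 + q) / 2) (t := (1 - q) / 2) (by linarith)
    (by linarith)).trans ?_
  refine (camel_walk (y := x + q) (t := 0) (by rw [abs_sub_comm]; linarith)
    (by rw [abs_sub_comm]; linarith)).trans ?_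
  rw [Multiset.cons_swap, Multiset.cons_swap (x + (1 + q) / 2)]
  exact camel_eat _ _

theorem camel_advance_half {x q : ℝ} (hq : 0 ≤ q) (hq' : q ≤ 1 / 2) (n : ℕ) :
    (⟨x, 0, false, Multiset.replicate (2 * (n + 1)) x + {x + q, x + q}⟩ : CamelState) ⟶*
      ⟨x + 1 / 2, 0, false, Multiset.replicate n (x + 1 / 2) +
        {x + 1 / 2 + (q / 2 + 1 / 8), x + 1 / 2 + (q / 2 + 1 / 8)}⟩ := by
  have e1 : Multiset.replicate (2 * (n + 1)) x + {x + q, x + q} =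
      Multiset.replicate (2 * n) x + (x ::ₘ x ::ₘ (x + q) ::ₘ (x + q) ::ₘ 0) := by
    rw [show 2 * (n + 1) = 2 * n + 1 + 1 by ring]
    rw [Multiset.replicate_succ, Multiset.replicate_succ]
    simp only [Multiset.insert_eq_cons, ← Multiset.singleton_add, add_zero]
    abel
  rw [e1]
  refine (camel_round_trips x n _).trans ?_
  rw [add_comm]
  simp only [Multiset.cons_add, zero_add]
  refine (camel_advance hq (by linarith) _).trans ?_
  have e2 : |x + 1 / 2 - (x + q)| = 1 / 2 - q := by rw [abs_of_nonneg (by linarith)]; ring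
  refine (camel_carry (y := x + 1 / 2) (t := 1 / 2 + q) (by linarith) (by linarith)).trans ?_
  refine (camel_gather_return (p := x + 1 / 2 + (q / 2 + 1 / 8)) (t := 0) (by linarith)
    (by linarith) le_rfl (by ring)).trans ?_
  rw [add_comm (Multiset.replicate n (x + 1 / 2))]
  exact .refl

theorem camel_final_stage {x q : ℝ} (hq : 0 ≤ q) (hq' : q ≤ 1 / 2) :
    ∃ S, (⟨x, 0, false, Multiset.replicate 2 x + {x + q, x + q}⟩ : CamelState) ⟶* S ∧
      S.pos = x + (8 / 3 + 2 * q / 3) := by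
  obtain ⟨S, hS, hpos⟩ := camel_two_bananas (x + (2 + 2 * q) / 3) 0
  refine ⟨S, ?_, by rw [hpos]; ring⟩
  refine Relation.ReflTransGen.trans (camel_advance hq (by linarith) 0) ?_
  exact (camel_gather (p := x + (2 + 2 * q) / 3) (t := 0) (by linarith) (by linarith) le_rfl
    (by ring)).trans hS

theorem camel_from_two_ahead (k : ℕ) (x q : ℝ) (hq : 0 ≤ q) (hq' : q ≤ 1 / 2) :
    ∃ S, (⟨x, 0, false, Multiset.replicate (2 ^ (k + 2) - 2) x + {x + q, x + q}⟩ :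
      CamelState) ⟶* S ∧
      S.pos = x + (((k : ℝ) + 2) / 2 + 11 / 6 + (4 * q - 1) / (3 * 2 ^ (k + 1))) := by
  induction k generalizing x q with
  | zero =>
    obtain ⟨S, hS, hpos⟩ := camel_final_stage (x := x) hq hq'
    refine ⟨S, hS, ?_⟩
    rw [hpos]
    norm_num
    ring
  | succ k ih =>
    obtain ⟨S, hS, hpos⟩ := ih (x + 1 / 2) (q / 2 + 1 / 8) (by linarith) (by linarith)
    refine ⟨S, ?_, ?_⟩
    · have h4 : 2 ^ (k + 1 + 2) - 2 = 2 * ((2 ^ (k + 2) - 2) + 1) := by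
        have : 4 ≤ 2 ^ (k + 2) := by
          rw [pow_add]; nlinarith [Nat.one_le_two_pow (n := k)]
        rw [show k + 1 + 2 = k + 2 + 1 by ring, pow_succ 2 (k + 2)]
        omega
      rw [h4]
      exact (camel_advance_half hq hq' _).trans hS
    · rw [hpos, pow_succ _ (k + 1)]
      push_cast
      field_simp
      ring

/-! ### Using the surplus `f` -/

/-- Use up `f - 1` units of fuel to bring one banana ahead, before eating the next one. -/
theorem camel_first_trip {f : ℝ} (hf : 1 ≤ f) (G : Multiset ℝ) :
    (⟨0, f - 1, false, 0 ::ₘ 0 ::ₘ 0 ::ₘ G⟩ : CamelState) ⟶*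
      ⟨0, 1, false, 0 ::ₘ ((f - 1) / 2) ::ₘ G⟩ := by
  have e : |(f - 1) / 2 - 0| = (f - 1) / 2 := by rw [sub_zero]; exact abs_of_nonneg (by linarith)
  refine (camel_carry (y := (f - 1) / 2) (t := (f - 1) / 2) (by linarith) (by linarith)).trans ?_
  refine (camel_walk (y := 0) (t := 0) (by rw [abs_sub_comm]; linarith)
    (by rw [abs_sub_comm]; linarith)).trans ?_
  rw [Multiset.cons_swap, Multiset.cons_swap ((f - 1) / 2)]
  exact camel_eat _ _

theorem camelStart_of_eq {N s : ℝ} {n : ℕ} (h : N = n + s) (h0 : 0 ≤ s) (h1 : s < 1) :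
    camelStart N = ⟨0, s, false, Multiset.replicate n 0⟩ := by
  have : ⌊N⌋₊ = n := by
    rw [Nat.floor_eq_iff (by rw [h]; positivity), h]
    exact ⟨by linarith, by linarith⟩
  rw [camelStart, this, h, add_sub_cancel_left]

/-- From the start with `n + 2 + f` bananas, `0 ≤ f ≤ 2`, the camel can bring itself into a
situation in which `f` units of fuel are available for the transport of two bananas. -/
theorem camelStart_cases {n : ℕ} {f : ℝ} (hf0 : 0 ≤ f) (hf2 : f ≤ 2) :
    (f < 1 ∧ camelStart ((n + 2 : ℕ) + f) ⟶*
        ⟨0, f, false, 0 ::ₘ 0 ::ₘ Multiset.replicate n 0⟩) ∨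
      (1 ≤ f ∧ camelStart ((n + 2 : ℕ) + f) ⟶*
        ⟨0, 1, false, 0 ::ₘ ((f - 1) / 2) ::ₘ Multiset.replicate n 0⟩) := by
  rcases lt_or_ge f 1 with h | h
  · left
    refine ⟨h, ?_⟩
    rw [camelStart_of_eq rfl hf0 h]
    exact .refl
  · right
    refine ⟨h, Relation.ReflTransGen.trans ?_ (camel_first_trip h _)⟩
    -- At `f = 2` the stomach is empty and the floor one larger, so a banana is eaten first.
    rcases hf2.lt_or_eq with h2 | rfl
    · rw [camelStart_of_eq (n := n + 3) (s := f - 1) (by push_cast; ring) (by linarith)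
        (by linarith)]
      exact .refl
    · rw [camelStart_of_eq (n := n + 4) (s := 0) (by push_cast; ring) le_rfl (by norm_num),
        show (2 : ℝ) - 1 = 1 by norm_num]
      exact camel_eat 0 (Multiset.replicate (n + 3) 0)

theorem camelCanReach_two_add {f : ℝ} (hf0 : 0 ≤ f) (hf2 : f ≤ 2) :
    CamelCanReach (2 + f) (2 + f / 3) := by
  have key : camelStart ((0 + 2 : ℕ) + f) ⟶* ⟨f / 3, 0, false, f / 3 ::ₘ f / 3 ::ₘ 0⟩ := by
    rcases camelStart_cases (n := 0) hf0 hf2 with ⟨-, h⟩ | ⟨-, h⟩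
    · exact h.trans (camel_gather (by linarith) (by linarith) le_rfl (by ring))
    · exact h.trans (camel_gather (by linarith) (by linarith) le_rfl (by ring))
  obtain ⟨S, hS, hpos⟩ := camel_two_bananas (f / 3) 0
  refine ⟨S, ?_, by rw [hpos]; ring⟩
  simpa using key.trans hS

theorem camelCanReach_two_pow_add (k : ℕ) {f : ℝ} (hf0 : 0 ≤ f) (hf2 : f ≤ 2) :
    CamelCanReach (2 ^ (k + 2) + f)
      (((k : ℝ) + 2) / 2 + 11 / 6 + (f - 1) / (3 * 2 ^ (k + 1))) := by
  have hk : 2 ^ (k + 2) - 2 + 2 = 2 ^ (k + 2) := by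
    have : 4 ≤ 2 ^ (k + 2) := by
      rw [pow_add]; nlinarith [Nat.one_le_two_pow (n := k)]
    omega
  have key : camelStart ((2 ^ (k + 2) - 2 + 2 : ℕ) + f) ⟶*
      ⟨0, 0, false, f / 4 ::ₘ f / 4 ::ₘ Multiset.replicate (2 ^ (k + 2) - 2) 0⟩ := by
    rcases camelStart_cases (n := 2 ^ (k + 2) - 2) hf0 hf2 with ⟨-, h⟩ | ⟨-, h⟩
    · exact h.trans (camel_gather_return (by linarith) (by linarith) le_rfl (by ring))
    · exact h.trans (camel_gather_return (by linarith) (by linarith) le_rfl (by ring))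
  obtain ⟨S, hS, hpos⟩ := camel_from_two_ahead k 0 (f / 4) (by linarith) (by linarith)
  refine ⟨S, ?_, by rw [hpos]; ring⟩
  rw [hk] at key
  push_cast at key
  refine key.trans ?_
  rwa [add_comm, zero_add] at hS

theorem mainTheorem4 (k : ℕ) (hk : 1 ≤ k) (f : ℝ) (hf0 : 0 ≤ f) (hf2 : f ≤ 2) :
    IsGreatest {d : ℝ | CamelCanReach ((2 : ℝ) ^ k + f) d}
      ((k : ℝ) / 2 + 11 / 6 + (f - 1) / (3 * (2 : ℝ) ^ (k - 1))) := by
  obtain ⟨m, rfl⟩ := Nat.exists_eq_add_of_le' hk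
  rw [Nat.add_sub_cancel]
  constructor
  · rcases m with _ | m
    · have := camelCanReach_two_add hf0 hf2
      simp only [Set.mem_ofPred_eq]
      convert this using 1
      · norm_num
      · norm_num
        ring
    · have := camelCanReach_two_pow_add m hf0 hf2
      simp only [Set.mem_ofPred_eq]
      convert this using 2
      push_cast
      ring
  · intro d hd
    by_contra! hlt
    have hg : (1 : ℝ) ≤ 2 ^ m := one_le_pow₀ (by norm_num)
    have h1 : (f - 1) / (3 * 2 ^ m) = (f - 1) / 2 ^ m / 3 := by field_simp
    -- This gives `d > m/2 + 2`, that is, `e > 0`.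
    have h2 : -1 ≤ (f - 1) / 2 ^ m := by
      rw [le_div_iff₀ (by positivity)]; linarith
    push_cast at hlt
    rw [h1] at hlt
    have h3 := CamelCanReach.le (by positivity) m hd (by linarith)
    have h4 : ((2 : ℝ) ^ (m + 1) + f - 1) / 2 ^ m = 2 + (f - 1) / 2 ^ m := by
      rw [pow_succ]; field_simp; ring
    rw [h4] at h3
    linarith
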